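/- Let $G\in\mathbb R^{N\times L}$ ($L\ge 1$) have no zero column, and put $\theta_{\max}=\max_{1\le i\le L}\|Ge_i\|_2$, $\theta_{\min}=\min_{1\le i\le L}\|Ge_i\|_2>0$, $\mu=\theta_{\max}^2/\theta_{\min}^2\ge 1$ and $\theta_{\mathrm{avg}}^2=(\theta_{\max}^2+\theta_{\min}^2)/2$. Let $\phi_1,\dots,\phi_K$ be random vectors in $\{\pm1\}^L$ all of whose $KL$ entries are independent and take the values $1$ and $-1$ with probability $1/2$ each, let $D_{\phi_k}$ be the diagonal matrix with diagonal $\phi_k$, and let $H\in\mathbb R^{KN\times L}$ be the matrix obtained by stacking the blocks $GD_{\phi_1},\dots,GD_{\phi_K}$ on top of each other. There are absolute constants $c,C>0$ such that for all $N,L,K,S$, all such $G$ and all $\delta\in(0,1)$: if $$K\ \ge\ c\,\delta^{-2}\mu^2 S\log L ,$$ then with probability at least $$1-2\exp\Bigl(-CK\min\Bigl\{\frac{\delta}{2\mu},\frac{\delta^2}{(2\mu)^2}\Bigr\}\Bigr)$$ the inequality $$\left|\frac{\|Hx\|_2^2}{K\theta_{\mathrm{avg}}^2}-1\right|\ \le\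 \frac{\mu-1+2\delta}{\mu+1}$$ holds for all $x\in\mathbb R^L$ with $\|x\|_2=1$ and at most $S$ nonzero entries. In other words, on this event the scaled matrix $A=\frac{1}{\sqrt K\,\theta_{\mathrm{avg}}}H$ has the restricted isometry property of order $S$ with constant $\varepsilon=\frac{\mu-1+2\delta}{\mu+1}\in(0,1)$: $(1-\varepsilon)\|x\|_2^2\le\|Ax\|_2^2\le(1+\varepsilon)\|x\|_2^2$ for all $x$ with at most $S$ nonzero entries. -/

import Mathlib

open MeasureTheory ProbabilityTheory

namespace MaskImaging

noncomputable section

/-- The law of a random sign: the values `1` and `-1` with probability `1/2` each. -/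
def rademacher : Measure ℝ :=
  (2⁻¹ : ENNReal) • Measure.dirac (1 : ℝ) + (2⁻¹ : ENNReal) • Measure.dirac (-1 : ℝ)

/-- The measurement matrix `H`: the `K` blocks `G * D_{φ₁}, …, G * D_{φ_K}` stacked on top of each
other. The row with index `(k, n)` is the `n`-th row of the `k`-th block. -/
def measurementMatrix {N L K : ℕ} (G : Matrix (Fin N) (Fin L) ℝ) (φ : Fin K → Fin L → ℝ) :
    Matrix (Fin K × Fin N) (Fin L) ℝ :=
  Matrix.of fun p l => (G * Matrix.diagonal (φ p.1)) p.2 l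

/-- The Euclidean norm of the `i`-th column `G eᵢ` of `G`. -/
def colNorm {N L : ℕ} (G : Matrix (Fin N) (Fin L) ℝ) (i : Fin L) : ℝ :=
  ‖Matrix.toEuclideanLin G (EuclideanSpace.single i (1 : ℝ))‖

/-- The largest column norm (a maximum over a finite set, nonempty when `0 < L`). -/
def thetaMax {N L : ℕ} (G : Matrix (Fin N) (Fin L) ℝ) : ℝ := ⨆ i, colNorm G i

/-- The smallest column norm (a minimum over a finite set, nonempty when `0 < L`). -/
def thetaMin {N L : ℕ} (G : Matrix (Fin N) (Fin L) ℝ) : ℝ := ⨅ i, colNorm G i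

/-- The ratio `μ = θ_max² / θ_min²`. -/
def condRatio {N L : ℕ} (G : Matrix (Fin N) (Fin L) ℝ) : ℝ := thetaMax G ^ 2 / thetaMin G ^ 2

/-- The averaged squared column norm `θ_avg² = (θ_max² + θ_min²) / 2`. -/
def thetaAvgSq {N L : ℕ} (G : Matrix (Fin N) (Fin L) ℝ) : ℝ :=
  (thetaMax G ^ 2 + thetaMin G ^ 2) / 2

/-- A vector with at most `S` nonzero entries. -/
def IsSparse {L : ℕ} (S : ℕ) (x : EuclideanSpace ℝ (Fin L)) : Prop :=
  {i : Fin L | x i ≠ 0}.ncard ≤ S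

/-- The `S`-sparse vectors on the unit sphere of `ℝ^L`. -/
def sparseSphere (S L : ℕ) : Set (EuclideanSpace ℝ (Fin L)) :=
  {x | ‖x‖ = 1 ∧ IsSparse S x}

/-- The restricted isometry property of order `S` with constant `ε ∈ (0, 1)`. -/
def HasRIP {ι : Type*} [Fintype ι] {L : ℕ} (A : Matrix ι (Fin L) ℝ) (S : ℕ) (ε : ℝ) : Prop :=
  0 < ε ∧ ε < 1 ∧ ∀ x : EuclideanSpace ℝ (Fin L), IsSparse S x →
    (1 - ε) * ‖x‖ ^ 2 ≤ ‖Matrix.toEuclideanLin A x‖ ^ 2 ∧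
      ‖Matrix.toEuclideanLin A x‖ ^ 2 ≤ (1 + ε) * ‖x‖ ^ 2

end

end MaskImaging

namespace MaskImaging

open scoped NNReal ENNReal

/-! For fixed `x`, `‖H x‖ ^ 2` is a sum of `K` independent copies of a Rademacher quadratic form,
with mean `K * ∑ i, ‖G eᵢ‖ ^ 2 * x i ^ 2`. On the unit sphere this mean lies between `K θ_min²` and
`K θ_max²`, whose midpoint is `K θ_avg²`; the half-width gives the error `(μ - 1) / (μ + 1)`, and a
fluctuation of at most `K δ θ_min²` adds `2 δ / (μ + 1)`.

Fluctuations for one vector: each row sum is sub-Gaussian, so its square has an exponential moment.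
Jensen's inequality, with the row variances as weights, transfers this to the whole block without
dependence on `N` (`integral_exp_sum_sq_le`), and Bernstein's inequality gives
`measure_rademacher_chaos_le`.

Uniformity: a grid on each coordinate subspace yields at most `L ^ (7 * S)` test vectors when `L ≥
2`. By polarisation, a bound on the grid implies twice that bound on the sparse sphere
(`abs_norm_sq_sub_norm_sq_le_of_net`). A union bound finishes: the lower bound on `K` lets half of
the Bernstein exponent absorb the entropy `7 S log L`. -/

lemma exp_le_one_add_add_sq_mul_exp_abs (y : ℝ) :
    Real.exp y ≤ 1 + y + y ^ 2 * Real.exp |y| := by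
  have h := Complex.norm_exp_sub_sum_le_norm_mul_exp (y : ℂ) 2
  have e : Complex.exp (y : ℂ) - ∑ m ∈ Finset.range 2, (y : ℂ) ^ m / m.factorial
      = ((Real.exp y - (1 + y) : ℝ) : ℂ) := by
    simp [Finset.sum_range_succ]
  rw [e, Complex.norm_real, Complex.norm_real, Real.norm_eq_abs, Real.norm_eq_abs, sq_abs] at h
  linarith [le_abs_self (Real.exp y - (1 + y))]

lemma sq_le_mul_exp_div {v : ℝ} (hv : 0 ≤ v) : v ^ 2 ≤ 128 * Real.exp (v / 8) := by
  have := Real.quadratic_le_exp_of_nonneg (x := v / 8) (by positivity)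
  nlinarith

/-- Families of random variables grouped into blocks along the first index are independent. -/
lemma iIndepFun_curry {Ω ι κ : Type*} [Countable ι] [Countable κ] [MeasurableSpace Ω]
    {P : Measure Ω} {X : ι → κ → Ω → ℝ} (hX : ∀ i j, AEMeasurable (X i j) P)
    (h : iIndepFun (fun p : ι × κ => X p.1 p.2) P) :
    iIndepFun (fun i ω j => X i j ω) P := by
  have := h.isProbabilityMeasure
  have h1 : iIndepFun (fun p : (_ : ι) × κ => X p.1 p.2) P :=
    h.precomp (Equiv.sigmaEquivProd ι κ).injective
  have hp : ∀ i j, IsProbabilityMeasure (P.map (X i j)) :=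
    fun i j => Measure.isProbabilityMeasure_map (hX i j)
  have hrow : ∀ i, iIndepFun (X i) P := fun i =>
    h.precomp (g := fun j => (i, j)) (Prod.mk_right_injective i)
  rw [iIndepFun_iff_map_fun_eq_infinitePi_map₀'
    (fun i => aemeasurable_pi_lambda _ fun j => hX i j)]
  -- The joint law is a product measure over pairs; currying turns it into a product of the row
  -- laws.
  have e : (fun ω i j => X i j ω) =
      (MeasurableEquiv.piCurry (fun (_ : ι) (_ : κ) => ℝ)) ∘ (fun ω p => X p.1 p.2 ω) := by
    ext; simp [Sigma.curry]
  rw [e, ← AEMeasurable.map_map_of_aemeasurable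
    (MeasurableEquiv.piCurry (fun (_ : ι) (_ : κ) => ℝ)).measurable.aemeasurable
    (aemeasurable_pi_lambda (fun ω (p : (_ : ι) × κ) => X p.1 p.2 ω) fun p => hX p.1 p.2),
    (iIndepFun_iff_map_fun_eq_infinitePi_map₀' (X := fun p : (_ : ι) × κ => X p.1 p.2)
      (fun p => hX p.1 p.2)).1 h1,
    Measure.infinitePi_map_piCurry (fun i j => P.map (X i j))]
  congr with i : 1
  rw [(iIndepFun_iff_map_fun_eq_infinitePi_map₀' (hX i)).1 (hrow i)]

/-! ### Moments of a random sign -/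

section Sign

variable {Ω : Type*} [MeasurableSpace Ω] {P : Measure Ω} {ξ : Ω → ℝ}

lemma integral_rademacher (f : ℝ → ℝ) : ∫ x, f x ∂rademacher = (f 1 + f (-1)) / 2 := by
  rw [rademacher, integral_add_measure, integral_smul_measure, integral_smul_measure,
    integral_dirac, integral_dirac]
  · simp; ring
  · exact (integrable_dirac (by simp)).smul_measure (by simp)
  · exact (integrable_dirac (by simp)).smul_measure (by simp)

lemma ae_rademacher_mem_Icc : ∀ᵐ x ∂rademacher, x ∈ Set.Icc (-1 : ℝ) 1 := by
  rw [rademacher, ae_add_measure_iff]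
  constructor <;> refine Measure.ae_smul_measure ?_ _ <;> rw [ae_dirac_eq] <;> simp

lemma _root_.ProbabilityTheory.HasLaw.ae_mem_Icc_of_rademacher (h : HasLaw ξ rademacher P) : ∀ᵐ ω ∂P, ξ ω ∈ Set.Icc (-1 : ℝ) 1 :=
  (h.ae_iff (p := fun x => x ∈ Set.Icc (-1 : ℝ) 1) (measurable_mem.2 measurableSet_Icc)).2
    ae_rademacher_mem_Icc

lemma _root_.ProbabilityTheory.HasLaw.memLp_of_rademacher [IsProbabilityMeasure P]
    (h : HasLaw ξ rademacher P) : MemLp ξ 2 P :=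
  memLp_of_bounded h.ae_mem_Icc_of_rademacher h.aemeasurable.aestronglyMeasurable 2

lemma _root_.ProbabilityTheory.HasLaw.integral_eq_zero_of_rademacher (h : HasLaw ξ rademacher P) : ∫ ω, ξ ω ∂P = 0 := by
  have := h.integral_comp (f := fun x : ℝ => x) (by fun_prop)
  simpa [integral_rademacher, Function.comp_def] using this

lemma _root_.ProbabilityTheory.HasLaw.variance_eq_one_of_rademacher [IsProbabilityMeasure P]
    (h : HasLaw ξ rademacher P) : Var[ξ; P] = 1 := by
  rw [variance_of_integral_eq_zero h.aemeasurable h.integral_eq_zero_of_rademacher]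
  have := h.integral_comp (f := fun x : ℝ => x ^ 2) (by fun_prop)
  simpa [integral_rademacher, Function.comp_def] using this

lemma _root_.ProbabilityTheory.HasLaw.hasSubgaussianMGF_of_rademacher [IsProbabilityMeasure P]
    (h : HasLaw ξ rademacher P) :
    HasSubgaussianMGF ξ 1 P := by
  have := hasSubgaussianMGF_of_mem_Icc h.aemeasurable h.ae_mem_Icc_of_rademacher
  rw [h.integral_eq_zero_of_rademacher] at this
  have e : (‖(1 : ℝ) - -1‖₊ / 2) ^ 2 = 1 := by
    rw [← NNReal.coe_inj]; norm_num
  rw [e] at this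
  simpa using this

end Sign

/-! ### Exponential moments of squared sub-Gaussian variables -/

section SquareExp

variable {Ω : Type*} [MeasurableSpace Ω] {P : Measure Ω}

lemma lintegral_exp_mul_gaussianReal (t : ℝ) :
    ∫⁻ g, ENNReal.ofReal (Real.exp (t * g)) ∂(gaussianReal 0 1)
      = ENNReal.ofReal (Real.exp (t ^ 2 / 2)) := by
  have h := congrFun (mgf_id_gaussianReal (μ := 0) (v := 1)) t
  rw [← ofReal_integral_eq_lintegral_ofReal]
  · simp only [mgf, id] at h
    rw [h]; simp
  · exact integrable_exp_mul_gaussianReal t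
  · exact Filter.Eventually.of_forall fun _ => (Real.exp_pos _).le

lemma lintegral_exp_sq_gaussianReal_le :
    ∫⁻ g, ENNReal.ofReal (Real.exp (g ^ 2 / 4)) ∂(gaussianReal 0 1) ≤ 2 := by
  have hi : Integrable (fun g : ℝ => Real.exp (-(1 / 4) * g ^ 2)) :=
    integrable_exp_neg_mul_sq (by norm_num)
  have e : ∀ g : ℝ, gaussianPDF 0 1 g * ENNReal.ofReal (Real.exp (g ^ 2 / 4))
      = ENNReal.ofReal ((√(2 * Real.pi))⁻¹ * Real.exp (-(1 / 4) * g ^ 2)) := by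
    intro g
    rw [gaussianPDF, ← ENNReal.ofReal_mul (gaussianPDFReal_nonneg _ _ _), gaussianPDFReal,
      mul_assoc, ← Real.exp_add]
    congr 3
    · simp
    · simp; ring
  rw [gaussianReal_of_var_ne_zero _ one_ne_zero, lintegral_withDensity_eq_lintegral_mul _
    (measurable_gaussianPDF _ _) (by fun_prop)]
  simp only [Pi.mul_apply, e]
  rw [← ofReal_integral_eq_lintegral_ofReal (hi.const_mul _)
    (Filter.Eventually.of_forall fun _ => by positivity), integral_const_mul, integral_gaussian]
  rw [← Real.sqrt_inv, ← Real.sqrt_mul (by positivity)]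
  have : (2 * Real.pi)⁻¹ * (Real.pi / (1 / 4)) = 2 := by field_simp; norm_num
  rw [this]
  calc ENNReal.ofReal (√2) ≤ ENNReal.ofReal 2 := by
        apply ENNReal.ofReal_le_ofReal
        rw [Real.sqrt_le_left (by norm_num)]; norm_num
    _ = 2 := by simp

/-- The square of a sub-Gaussian variable has an exponential moment. -/
lemma lintegral_exp_mul_sq_le [SFinite P] {X : Ω → ℝ} {c : ℝ≥0} (hX : HasSubgaussianMGF X c P)
    {s : ℝ} (hs : 0 ≤ s) (hsc : 4 * (s * c) ≤ 1) :
    ∫⁻ ω, ENNReal.ofReal (Real.exp (s * X ω ^ 2)) ∂P ≤ 2 := by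
  -- Gaussian linearisation: the square in the exponent becomes linear in `X` at the cost of an
  -- average over `g`. After Tonelli, the sub-Gaussian bound for fixed `g` gives `exp (s c g²) ≤ exp
  -- (g² / 4)`.
  have e : ∀ ω, ENNReal.ofReal (Real.exp (s * X ω ^ 2)) =
      ∫⁻ g, ENNReal.ofReal (Real.exp (√(2 * s) * X ω * g)) ∂(gaussianReal 0 1) := by
    intro ω
    rw [lintegral_exp_mul_gaussianReal, mul_pow, Real.sq_sqrt (by positivity)]
    congr 2; ring
  simp_rw [e]
  have hm : AEMeasurable X P := hX.aemeasurable
  rw [lintegral_lintegral_swap]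
  · refine le_trans (lintegral_mono fun g => ?_) lintegral_exp_sq_gaussianReal_le
    have e2 : ∀ ω, √(2 * s) * X ω * g = (√(2 * s) * g) * X ω := fun ω => by ring
    simp_rw [e2]
    rw [← ofReal_integral_eq_lintegral_ofReal (hX.integrable_exp_mul _)
      (Filter.Eventually.of_forall fun _ => (Real.exp_pos _).le)]
    apply ENNReal.ofReal_le_ofReal
    refine (hX.mgf_le _).trans ?_
    rw [Real.exp_le_exp, mul_pow, Real.sq_sqrt (by positivity)]
    nlinarith [sq_nonneg g]
  · have h1 : AEMeasurable (fun p : Ω × ℝ => X p.1) (P.prod (gaussianReal 0 1)) := hm.comp_fst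
    have h2 : AEMeasurable (fun p : Ω × ℝ => p.2) (P.prod (gaussianReal 0 1)) :=
      measurable_snd.aemeasurable
    exact (((h1.const_mul _).mul h2).exp).ennreal_ofReal

lemma integrable_exp_mul_sq [SFinite P] {X : Ω → ℝ} {c : ℝ≥0} (hX : HasSubgaussianMGF X c P)
    {s : ℝ} (hs : 0 ≤ s) (hsc : 4 * (s * c) ≤ 1) :
    Integrable (fun ω => Real.exp (s * X ω ^ 2)) P := by
  refine (lintegral_ofReal_ne_top_iff_integrable ?_ ?_).1 ?_
  · exact (((hX.aemeasurable.pow_const 2).const_mul s).exp).aestronglyMeasurable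
  · exact Filter.Eventually.of_forall fun _ => (Real.exp_pos _).le
  · exact ne_top_of_le_ne_top (by simp) (lintegral_exp_mul_sq_le hX hs hsc)

lemma integral_exp_mul_sq_le [SFinite P] {X : Ω → ℝ} {c : ℝ≥0} (hX : HasSubgaussianMGF X c P)
    {s : ℝ} (hs : 0 ≤ s) (hsc : 4 * (s * c) ≤ 1) :
    ∫ ω, Real.exp (s * X ω ^ 2) ∂P ≤ 2 := by
  rw [integral_eq_lintegral_of_nonneg_ae (Filter.Eventually.of_forall fun _ => (Real.exp_pos _).le)
    (integrable_exp_mul_sq hX hs hsc).aestronglyMeasurable]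
  exact ENNReal.toReal_le_of_le_ofReal (by norm_num)
    ((lintegral_exp_mul_sq_le hX hs hsc).trans (by simp))

end SquareExp

/-! ### Exponential moment of a Rademacher quadratic form -/

section QuadraticForm

variable {Ω : Type*} [MeasurableSpace Ω] {P : Measure Ω}
  {N L : ℕ} {b : Fin N → Fin L → ℝ} {ξ : Fin L → Ω → ℝ}

lemma hasSubgaussianMGF_sum_rademacher [IsProbabilityMeasure P]
    (hξ : ∀ i, HasLaw (ξ i) rademacher P)
    (hind : iIndepFun ξ P) (a : Fin L → ℝ) :
    HasSubgaussianMGF (fun ω => ∑ i, a i * ξ i ω) (∑ i, (a i ^ 2).toNNReal) P := by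
  have h1 : iIndepFun (fun i ω => a i * ξ i ω) P :=
    hind.comp (fun i x => a i * x) fun i => by fun_prop
  exact HasSubgaussianMGF.sum_of_iIndepFun h1
    fun i _ => by
      have := (hξ i).hasSubgaussianMGF_of_rademacher.const_mul (a i)
      convert this using 1
      rw [← NNReal.coe_inj, Real.coe_toNNReal _ (sq_nonneg _)]
      exact (mul_one (a i ^ 2)).symm

lemma integral_sq_sum_rademacher [IsProbabilityMeasure P]
    (hξ : ∀ i, HasLaw (ξ i) rademacher P)
    (hind : iIndepFun ξ P) (a : Fin L → ℝ) :
    ∫ ω, (∑ i, a i * ξ i ω) ^ 2 ∂P = ∑ i, a i ^ 2 := by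
  have h1 : iIndepFun (fun i ω => a i * ξ i ω) P :=
    hind.comp (fun i x => a i * x) fun i => by fun_prop
  have hL : ∀ i, MemLp (fun ω => a i * ξ i ω) 2 P :=
    fun i => (hξ i).memLp_of_rademacher.const_mul (a i)
  have h0 : ∫ ω, (∑ i, a i * ξ i ω) ∂P = 0 := by
    rw [integral_finsetSum _ fun i _ => (hL i).integrable (by norm_num)]
    refine Finset.sum_eq_zero fun i _ => ?_
    rw [integral_const_mul, (hξ i).integral_eq_zero_of_rademacher, mul_zero]
  have hv := IndepFun.variance_sum (s := Finset.univ) (fun i _ => hL i)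
    (fun i _ j _ hij => h1.indepFun hij)
  rw [← variance_of_integral_eq_zero (Finset.aemeasurable_fun_sum _
    fun i _ => (hL i).aestronglyMeasurable.aemeasurable) h0]
  have e : (fun ω => ∑ i, a i * ξ i ω) = ∑ i, fun ω => a i * ξ i ω := by
    ext; simp
  rw [e, hv]
  refine Finset.sum_congr rfl fun i _ => ?_
  rw [variance_const_mul, (hξ i).variance_eq_one_of_rademacher, mul_one]

lemma integral_sum_sq_sum_rademacher [IsProbabilityMeasure P]
    (hξ : ∀ i, HasLaw (ξ i) rademacher P)
    (hind : iIndepFun ξ P) :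
    ∫ ω, ∑ n, (∑ i, b n i * ξ i ω) ^ 2 ∂P = ∑ n, ∑ i, b n i ^ 2 := by
  rw [integral_finsetSum]
  · exact Finset.sum_congr rfl fun n _ => integral_sq_sum_rademacher hξ hind (b n)
  · intro n _
    exact ((hasSubgaussianMGF_sum_rademacher hξ hind (b n)).memLp 2).integrable_sq

/-- Jensen's inequality for a sum of squares. -/
lemma exp_sum_sq_div_le {τ : ℝ} (hτ : 0 < τ) {c x : Fin N → ℝ} (hc : ∀ n, 0 ≤ c n)
    (hcτ : ∑ n, c n ≤ τ) (h0 : ∀ n, c n = 0 → x n = 0) :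
    Real.exp ((∑ n, x n ^ 2) / τ / 4) ≤
      (1 - ∑ n, c n / τ) + ∑ n, c n / τ * Real.exp ((4 * c n)⁻¹ * x n ^ 2) := by
  -- The weights `c n / τ` may sum to less than one; the missing mass sits at the point `0`.
  have h := convexOn_exp.map_add_sum_le (t := Finset.univ) (w := fun n => c n / τ)
    (v := 1 - ∑ n, c n / τ) (q := 0) (p := fun n => (4 * c n)⁻¹ * x n ^ 2)
    (fun n _ => div_nonneg (hc n) hτ.le) (by simp) (fun _ _ => Set.mem_univ _)
    (by rw [← Finset.sum_div, sub_nonneg]; exact (div_le_one hτ).2 hcτ) (Set.mem_univ _)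
  simp only [smul_eq_mul, mul_zero, zero_add, Real.exp_zero, mul_one] at h
  refine le_trans (le_of_eq ?_) h
  rw [div_div, Finset.sum_div]
  congr 1
  refine Finset.sum_congr rfl fun n _ => ?_
  rcases eq_or_ne (c n) 0 with hn | hn
  -- Here `(4 * c n)⁻¹` is `0` by convention, so the vanishing of `x n` is needed.
  · simp [h0 n hn]
  · field_simp

lemma inv_four_mul_sum_sq_nonneg (a : Fin L → ℝ) : 0 ≤ (4 * ∑ i, a i ^ 2)⁻¹ :=
  inv_nonneg.2 (mul_nonneg (by norm_num) (Finset.sum_nonneg fun i _ => sq_nonneg _))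

lemma four_mul_inv_mul_sum_sq_le (a : Fin L → ℝ) :
    4 * ((4 * ∑ i, a i ^ 2)⁻¹ * ((∑ i, (a i ^ 2).toNNReal : ℝ≥0) : ℝ)) ≤ 1 := by
  have e : ((∑ i, (a i ^ 2).toNNReal : ℝ≥0) : ℝ) = ∑ i, a i ^ 2 := by
    simp [NNReal.coe_sum, Real.coe_toNNReal _ (sq_nonneg _)]
  have h0 : 0 ≤ ∑ i, a i ^ 2 := Finset.sum_nonneg fun i _ => sq_nonneg _
  rw [e]
  rcases h0.eq_or_lt with h | h
  · rw [← h]; simp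
  · apply le_of_eq; field_simp

/-- Each row is normalised by its own variance and weighted by its share of `τ`, so the expectation
of the right side is bounded independently of the number of rows. -/
lemma exp_sum_sq_sum_le {τ : ℝ} (hτ : 0 < τ) (hb : ∑ n, ∑ i, b n i ^ 2 ≤ τ) (x : Fin L → ℝ) :
    Real.exp ((∑ n, (∑ i, b n i * x i) ^ 2) / τ / 4) ≤
      (1 - ∑ n, (∑ i, b n i ^ 2) / τ) + ∑ n, (∑ i, b n i ^ 2) / τ *
        Real.exp ((4 * ∑ i, b n i ^ 2)⁻¹ * (∑ i, b n i * x i) ^ 2) := by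
  refine exp_sum_sq_div_le hτ (fun n => Finset.sum_nonneg fun i _ => sq_nonneg _) hb ?_
  intro n hn
  rw [Finset.sum_eq_zero_iff_of_nonneg fun i _ => sq_nonneg _] at hn
  refine Finset.sum_eq_zero fun i hi => ?_
  rw [pow_eq_zero_iff (by norm_num) |>.1 (hn i hi), zero_mul]

lemma aemeasurable_sum_sq (hξ : ∀ i, HasLaw (ξ i) rademacher P) :
    AEMeasurable (fun ω => ∑ n, (∑ i, b n i * ξ i ω) ^ 2) P :=
  Finset.aemeasurable_fun_sum _ fun _ _ => (Finset.aemeasurable_fun_sum _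
    fun i _ => (hξ i).aemeasurable.const_mul _).pow_const 2

lemma integrable_exp_sum_sq_bound [IsProbabilityMeasure P] {τ : ℝ}
    (hξ : ∀ i, HasLaw (ξ i) rademacher P) (hind : iIndepFun ξ P) (n : Fin N) :
    Integrable (fun ω => (∑ i, b n i ^ 2) / τ *
        Real.exp ((4 * ∑ i, b n i ^ 2)⁻¹ * (∑ i, b n i * ξ i ω) ^ 2)) P :=
  (integrable_exp_mul_sq (hasSubgaussianMGF_sum_rademacher hξ hind (b n))
    (inv_four_mul_sum_sq_nonneg (b n)) (four_mul_inv_mul_sum_sq_le (b n))).const_mul _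

lemma integrable_exp_sum_sq [IsProbabilityMeasure P] {τ : ℝ} (hτ : 0 < τ)
    (hξ : ∀ i, HasLaw (ξ i) rademacher P) (hind : iIndepFun ξ P)
    (hb : ∑ n, ∑ i, b n i ^ 2 ≤ τ) :
    Integrable (fun ω => Real.exp ((∑ n, (∑ i, b n i * ξ i ω) ^ 2) / τ / 4)) P := by
  refine Integrable.mono' ((integrable_const (1 - ∑ n, (∑ i, b n i ^ 2) / τ)).add
    (integrable_finsetSum Finset.univ
      fun n _ => integrable_exp_sum_sq_bound (τ := τ) (b := b) hξ hind n))
    (((aemeasurable_sum_sq hξ).div_const τ).div_const 4).exp.aestronglyMeasurable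
    (Filter.Eventually.of_forall fun ω => ?_)
  rw [Real.norm_eq_abs, Real.abs_exp]
  exact exp_sum_sq_sum_le hτ hb _

lemma integral_exp_sum_sq_le [IsProbabilityMeasure P] {τ : ℝ} (hτ : 0 < τ)
    (hξ : ∀ i, HasLaw (ξ i) rademacher P) (hind : iIndepFun ξ P)
    (hb : ∑ n, ∑ i, b n i ^ 2 ≤ τ) :
    ∫ ω, Real.exp ((∑ n, (∑ i, b n i * ξ i ω) ^ 2) / τ / 4) ∂P ≤ 2 := by
  have hi : Integrable (fun ω => ∑ n, (∑ i, b n i ^ 2) / τ *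
        Real.exp ((4 * ∑ i, b n i ^ 2)⁻¹ * (∑ i, b n i * ξ i ω) ^ 2)) P :=
    integrable_finsetSum _ fun n _ => integrable_exp_sum_sq_bound hξ hind n
  have hw : ∑ n, (∑ i, b n i ^ 2) / τ ≤ 1 := by
    rw [← Finset.sum_div]; exact (div_le_one hτ).2 hb
  calc _ ≤ ∫ ω, ((1 - ∑ n, (∑ i, b n i ^ 2) / τ) + ∑ n, (∑ i, b n i ^ 2) / τ *
        Real.exp ((4 * ∑ i, b n i ^ 2)⁻¹ * (∑ i, b n i * ξ i ω) ^ 2)) ∂P :=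
        integral_mono (integrable_exp_sum_sq hτ hξ hind hb) ((integrable_const _).add hi)
          fun ω => exp_sum_sq_sum_le hτ hb _
    _ = (1 - ∑ n, (∑ i, b n i ^ 2) / τ) + ∑ n, (∑ i, b n i ^ 2) / τ *
        ∫ ω, Real.exp ((4 * ∑ i, b n i ^ 2)⁻¹ * (∑ i, b n i * ξ i ω) ^ 2) ∂P := by
        rw [integral_add (integrable_const _) hi, integral_finsetSum _
          fun n _ => integrable_exp_sum_sq_bound hξ hind n]
        simp only [integral_const_mul, integral_const, probReal_univ, one_smul]
    _ ≤ (1 - ∑ n, (∑ i, b n i ^ 2) / τ) + ∑ n, (∑ i, b n i ^ 2) / τ * 2 := by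
        gcongr with n _
        exact integral_exp_mul_sq_le (hasSubgaussianMGF_sum_rademacher hξ hind (b n))
          (inv_four_mul_sum_sq_nonneg (b n)) (four_mul_inv_mul_sum_sq_le (b n))
    _ ≤ 2 := by rw [← Finset.sum_mul]; linarith

end QuadraticForm

/-! ### Bernstein's inequality -/

section Bernstein

variable {Ω : Type*} [MeasurableSpace Ω] {P : Measure Ω}

/-- Second-order Taylor expansion. Both `(w - f) ^ 2` and the exponential remainder are controlled
by `exp ((w + 1) / 8)`, so their product costs only `exp (w / 4)`, the moment at hand. -/
lemma exp_mul_sub_le {w f l : ℝ} (hw : 0 ≤ w) (hf0 : 0 ≤ f) (hf1 : f ≤ 1) (hl : |l| ≤ 1 / 8) :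
    Real.exp (l * (w - f)) ≤ 1 + l * (w - f) + l ^ 2 * (256 * Real.exp (w / 4)) := by
  have hd : |w - f| ≤ w + 1 := by rw [abs_le]; constructor <;> linarith
  have h1 : |l * (w - f)| ≤ (w + 1) / 8 := by
    rw [abs_mul]
    calc |l| * |w - f| ≤ 1 / 8 * (w + 1) := by gcongr
      _ = (w + 1) / 8 := by ring
  have h2 : (w - f) ^ 2 ≤ 128 * Real.exp ((w + 1) / 8) :=
    (sq_le_sq' (by linarith [neg_abs_le (w - f)]) ((le_abs_self _).trans hd)).trans
      (sq_le_mul_exp_div (by linarith))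
  have h3 : Real.exp (1 / 4) ≤ 2 := by
    have := Real.exp_bound_div_one_sub_of_interval (x := 1 / 4) (by norm_num) (by norm_num)
    linarith [this.trans (by norm_num : (1 : ℝ) / (1 - 1 / 4) ≤ 2)]
  calc Real.exp (l * (w - f))
      ≤ 1 + l * (w - f) + (l * (w - f)) ^ 2 * Real.exp |l * (w - f)| :=
        exp_le_one_add_add_sq_mul_exp_abs _
    _ ≤ 1 + l * (w - f) +
        l ^ 2 * (128 * Real.exp ((w + 1) / 8)) * Real.exp ((w + 1) / 8) := by
        rw [mul_pow]; gcongr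
    _ = 1 + l * (w - f) + l ^ 2 * (128 * (Real.exp (1 / 4) * Real.exp (w / 4))) := by
        rw [← Real.exp_add, mul_assoc, mul_assoc, ← Real.exp_add]; ring_nf
    _ ≤ 1 + l * (w - f) + l ^ 2 * (128 * (2 * Real.exp (w / 4))) := by gcongr
    _ = _ := by ring

/-- A nonnegative variable with an exponential moment and mean at most one is, after centering,
sub-exponential. -/
lemma integrable_exp_mul_centered {W : Ω → ℝ} (hm : AEMeasurable W P) (hW : ∀ ω, 0 ≤ W ω)
    (hi : Integrable (fun ω => Real.exp (W ω / 4)) P) {f : ℝ} {l : ℝ} (hl : |l| ≤ 1 / 8) :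
    Integrable (fun ω => Real.exp (l * (W ω - f))) P := by
  refine Integrable.mono' (hi.mul_const (Real.exp (-(l * f))))
    ((hm.sub_const f).const_mul l).exp.aestronglyMeasurable
    (Filter.Eventually.of_forall fun ω => ?_)
  rw [Real.norm_eq_abs, Real.abs_exp, ← Real.exp_add, Real.exp_le_exp]
  nlinarith [hW ω, le_abs_self l]

/-- The linear Taylor term has mean zero, and the quadratic one costs `256 * 2 * l ^ 2`. -/
lemma integral_exp_mul_centered_le [IsProbabilityMeasure P] {W : Ω → ℝ} (hm : AEMeasurable W P) (hW : ∀ ω, 0 ≤ W ω)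
    (hi : Integrable (fun ω => Real.exp (W ω / 4)) P)
    (h2 : ∫ ω, Real.exp (W ω / 4) ∂P ≤ 2) {f : ℝ} (hf : ∫ ω, W ω ∂P = f) (hf1 : f ≤ 1)
    {l : ℝ} (hl : |l| ≤ 1 / 8) :
    ∫ ω, Real.exp (l * (W ω - f)) ∂P ≤ Real.exp (512 * l ^ 2) := by
  have hf0 : 0 ≤ f := hf ▸ integral_nonneg hW
  have hWi : Integrable W P := by
    refine Integrable.mono' (hi.const_mul 4) hm.aestronglyMeasurable
      (Filter.Eventually.of_forall fun ω => ?_)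
    rw [Real.norm_of_nonneg (hW ω)]
    linarith [Real.add_one_le_exp (W ω / 4)]
  have i0 : Integrable (fun ω => l * (W ω - f)) P :=
    (hWi.sub (integrable_const _)).const_mul l
  have i1 : Integrable (fun ω => 1 + l * (W ω - f)) P :=
    (integrable_const _).add i0
  have i2 : Integrable (fun ω => l ^ 2 * (256 * Real.exp (W ω / 4))) P :=
    (hi.const_mul _).const_mul _
  calc ∫ ω, Real.exp (l * (W ω - f)) ∂P
      ≤ ∫ ω, (1 + l * (W ω - f) + l ^ 2 * (256 * Real.exp (W ω / 4))) ∂P :=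
        integral_mono (integrable_exp_mul_centered hm hW hi hl) (i1.add i2)
          fun ω => exp_mul_sub_le (hW ω) hf0 hf1 hl
    _ = 1 + l ^ 2 * (256 * ∫ ω, Real.exp (W ω / 4) ∂P) := by
        have e1 : ∫ ω, (W ω - f) ∂P = 0 := by
          rw [integral_sub hWi (integrable_const _), hf]; simp
        have e2 : ∫ ω, (1 + l * (W ω - f)) ∂P = 1 := by
          rw [integral_add (integrable_const _) i0, integral_const_mul, e1]; simp
        rw [integral_add i1 i2, e2, integral_const_mul, integral_const_mul]
    _ ≤ 1 + 512 * l ^ 2 := by nlinarith [sq_nonneg l]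
    _ ≤ _ := by linarith [Real.add_one_le_exp (512 * l ^ 2)]

lemma measure_sum_ge_le_of_mgf_le [IsProbabilityMeasure P] {K : ℕ} {Y : Fin K → Ω → ℝ} (hm : ∀ k, AEMeasurable (Y k) P)
    (hind : iIndepFun Y P) {l t : ℝ} (hl : 0 ≤ l)
    (hi : ∀ k, Integrable (fun ω => Real.exp (l * Y k ω)) P)
    (hY : ∀ k, ∫ ω, Real.exp (l * Y k ω) ∂P ≤ Real.exp (512 * l ^ 2)) :
    P.real {ω | K * t ≤ ∑ k, Y k ω} ≤ Real.exp (K * (512 * l ^ 2 - l * t)) := by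
  -- Without integrability the mgf of the sum would be `0` by convention, yet it is a product of
  -- positive factors.
  have hint : Integrable (fun ω => Real.exp (l * (∑ k, Y k) ω)) P := by
    by_contra hcon
    have h1 : mgf (∑ k, Y k) P l = 0 := mgf_undef hcon
    rw [hind.mgf_sum₀ hm, Finset.prod_eq_zero_iff] at h1
    obtain ⟨k, _, hk⟩ := h1
    exact (mgf_pos (hi k)).ne' hk
  have h := measure_ge_le_exp_mul_mgf (K * t) hl hint
  rw [hind.mgf_sum₀ hm] at h
  simp only [Finset.sum_apply] at h
  refine h.trans ?_
  calc _ ≤ Real.exp (-l * (K * t)) * ∏ k : Fin K, Real.exp (512 * l ^ 2) := by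
        gcongr with k _
        · exact fun _ _ => mgf_nonneg
        · exact hY k
    _ = _ := by
        rw [Finset.prod_const, ← Real.exp_nat_mul, ← Real.exp_add, Finset.card_univ,
          Fintype.card_fin]
        congr 1; ring

/-- Bernstein's inequality. -/
lemma measure_abs_sum_ge_le [IsProbabilityMeasure P] {K : ℕ} {Y : Fin K → Ω → ℝ} (hm : ∀ k, AEMeasurable (Y k) P)
    (hind : iIndepFun Y P)
    (hi : ∀ k, ∀ l : ℝ, |l| ≤ 1 / 8 → Integrable (fun ω => Real.exp (l * Y k ω)) P)
    (hY : ∀ k, ∀ l : ℝ, |l| ≤ 1 / 8 →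
      ∫ ω, Real.exp (l * Y k ω) ∂P ≤ Real.exp (512 * l ^ 2))
    {t : ℝ} (ht0 : 0 ≤ t) (ht1 : t ≤ 1) :
    P.real {ω | K * t ≤ |∑ k, Y k ω|} ≤ 2 * Real.exp (-(K * t ^ 2 / 2048)) := by
  -- `l = t / 1024` minimises `512 l² - l t`.
  have hl0 : 0 ≤ t / 1024 := by positivity
  have hl : |t / 1024| ≤ 1 / 8 := by rw [abs_of_nonneg hl0]; linarith
  have hl' : |(-(t / 1024))| ≤ 1 / 8 := by rwa [abs_neg]
  have e : (K : ℝ) * (512 * (t / 1024) ^ 2 - t / 1024 * t) = -(K * t ^ 2 / 2048) := by ring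
  have h1 := measure_sum_ge_le_of_mgf_le (t := t) hm hind hl0 (fun k => hi k _ hl)
    fun k => hY k _ hl
  have h2 := measure_sum_ge_le_of_mgf_le (Y := fun k ω => -Y k ω) (t := t) (fun k => (hm k).neg)
    (hind.comp (fun _ x => -x) fun _ => measurable_neg) hl0
    (fun k => by simpa using hi k _ hl')
    (fun k => by simpa using hY k _ hl')
  rw [e] at h1 h2
  have hsub : {ω | K * t ≤ |∑ k, Y k ω|} ⊆
      {ω | K * t ≤ ∑ k, Y k ω} ∪ {ω | K * t ≤ ∑ k, -Y k ω} := by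
    intro ω hω
    rw [Set.mem_ofPred_eq, le_abs] at hω
    simpa using hω
  calc _ ≤ _ := measureReal_mono hsub
    _ ≤ _ := measureReal_union_le _ _
    _ ≤ _ := by linarith

end Bernstein

/-- Concentration of a sum of `K` independent copies of a Rademacher quadratic form. -/
lemma measure_rademacher_chaos_le {Ω : Type*} [MeasurableSpace Ω] {P : Measure Ω}
    [IsProbabilityMeasure P] {N L K : ℕ} {b : Fin N → Fin L → ℝ} {φ : Fin K → Fin L → Ω → ℝ}
    (hφ : ∀ k i, HasLaw (φ k i) rademacher P)
    (hind : iIndepFun (fun p : Fin K × Fin L => φ p.1 p.2) P)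
    {τ : ℝ} (hτ : 0 < τ) (hb : ∑ n, ∑ i, b n i ^ 2 ≤ τ) {t : ℝ} (ht0 : 0 ≤ t) (ht1 : t ≤ 1) :
    P.real {ω | K * t * τ ≤
        |∑ k, ∑ n, (∑ i, b n i * φ k i ω) ^ 2 - K * ∑ n, ∑ i, b n i ^ 2|} ≤
      2 * Real.exp (-(K * t ^ 2 / 2048)) := by
  set F := ∑ n, ∑ i, b n i ^ 2 with hF
  have hrow : ∀ k, iIndepFun (φ k) P := fun k =>
    hind.precomp (g := fun i => (k, i)) (Prod.mk_right_injective k)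
  have hWm : ∀ k, AEMeasurable (fun ω => (∑ n, (∑ i, b n i * φ k i ω) ^ 2) / τ) P :=
    fun k => (aemeasurable_sum_sq (hφ k)).div_const τ
  have hW0 : ∀ k ω, 0 ≤ (∑ n, (∑ i, b n i * φ k i ω) ^ 2) / τ := fun k ω =>
    div_nonneg (Finset.sum_nonneg fun _ _ => sq_nonneg _) hτ.le
  have hblock : iIndepFun (fun k ω => (∑ n, (∑ i, b n i * φ k i ω) ^ 2) / τ - F / τ) P :=
    (iIndepFun_curry (fun k i => (hφ k i).aemeasurable) hind).comp
      (fun _ v => (∑ n, (∑ i, b n i * v i) ^ 2) / τ - F / τ) fun _ => by fun_prop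
  have h := measure_abs_sum_ge_le (fun k => (hWm k).sub_const (F / τ)) hblock
    (fun k l hl => integrable_exp_mul_centered (hWm k) (hW0 k)
      (integrable_exp_sum_sq hτ (hφ k) (hrow k) hb) hl)
    (fun k l hl => integral_exp_mul_centered_le (hWm k) (hW0 k)
      (integrable_exp_sum_sq hτ (hφ k) (hrow k) hb)
      (integral_exp_sum_sq_le hτ (hφ k) (hrow k) hb)
      (by rw [integral_div, integral_sum_sq_sum_rademacher (hφ k) (hrow k)])
      ((div_le_one hτ).2 hb) hl) ht0 ht1
  refine le_trans (le_of_eq ?_) h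
  congr 1
  ext ω
  simp only [Set.mem_ofPred_eq]
  have e : ∑ k, ((∑ n, (∑ i, b n i * φ k i ω) ^ 2) / τ - F / τ) =
      (∑ k, ∑ n, (∑ i, b n i * φ k i ω) ^ 2 - K * F) / τ := by
    rw [Finset.sum_sub_distrib, ← Finset.sum_div, Finset.sum_const, Finset.card_univ,
      Fintype.card_fin, nsmul_eq_mul]
    ring
  rw [e, abs_div, abs_of_pos hτ, le_div_iff₀ hτ]

/-! ### From a net to the unit ball -/

section Net

variable {E F F' : Type*} [NormedAddCommGroup E] [NormedSpace ℝ E]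
  [NormedAddCommGroup F] [InnerProductSpace ℝ F] [NormedAddCommGroup F'] [InnerProductSpace ℝ F']

/-- Polarisation of `⟪T (x - y), T (x + y)⟫`. The factors `4` and `4⁻¹` cancel in the product and
balance a short `x - y` against a long `x + y`. -/
lemma norm_sq_sub_norm_sq_eq (T : E →ₗ[ℝ] F) (x y : E) :
    ‖T x‖ ^ 2 - ‖T y‖ ^ 2 =
      (‖T ((4 : ℝ) • (x - y) + (4 : ℝ)⁻¹ • (x + y))‖ ^ 2 -
        ‖T ((4 : ℝ) • (x - y) - (4 : ℝ)⁻¹ • (x + y))‖ ^ 2) / 4 := by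
  simp only [map_add, map_sub, map_smul, norm_add_sq_real, norm_sub_sq_real, inner_smul_left,
    inner_smul_right, inner_add_right, inner_sub_left, real_inner_self_eq_norm_sq,
    real_inner_comm (T x) (T y), conj_trivial]
  ring

/-- A difference of two squared seminorms that is small on a net of the unit ball of a subspace is
small on the whole unit ball of that subspace. -/
lemma abs_norm_sq_sub_norm_sq_le_of_net [FiniteDimensional ℝ E] (T : E →ₗ[ℝ] F) (D : E →ₗ[ℝ] F')
    (V : Submodule ℝ E) (A : Set E) (hA : ∀ x ∈ V, ‖x‖ ≤ 1 → ∃ y ∈ A, y ∈ V ∧ ‖x - y‖ ≤ 1 / 8)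
    (hA1 : ∀ y ∈ A, ‖y‖ ≤ 1) {η : ℝ} (hη : ∀ y ∈ A, |‖T y‖ ^ 2 - ‖D y‖ ^ 2| ≤ η)
    {x : E} (hxV : x ∈ V) (hx : ‖x‖ ≤ 1) : |‖T x‖ ^ 2 - ‖D x‖ ^ 2| ≤ 2 * η := by
  have hT : Continuous T := T.continuous_of_finiteDimensional
  have hD : Continuous D := D.continuous_of_finiteDimensional
  have : ProperSpace E := FiniteDimensional.proper ℝ E
  have hcomp : IsCompact ((V : Set E) ∩ Metric.closedBall 0 1) :=
    (isCompact_closedBall 0 1).inter_left V.closed_of_finiteDimensional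
  have hcont : ContinuousOn (fun x => |‖T x‖ ^ 2 - ‖D x‖ ^ 2|)
      ((V : Set E) ∩ Metric.closedBall 0 1) := by fun_prop
  obtain ⟨z, ⟨hzV, hz⟩, hmax⟩ := hcomp.exists_isMaxOn ⟨0, V.zero_mem, by simp⟩ hcont
  have hle : ∀ w ∈ V, ‖w‖ ≤ 1 → |‖T w‖ ^ 2 - ‖D w‖ ^ 2| ≤ |‖T z‖ ^ 2 - ‖D z‖ ^ 2| :=
    fun w hwV hw => hmax ⟨hwV, by simpa using hw⟩
  have hz1 : ‖z‖ ≤ 1 := by simpa using hz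
  refine (hle x hxV hx).trans ?_
  obtain ⟨y, hyA, hyV, hy⟩ := hA z hzV hz1
  -- Both polarisation vectors have norm at most `1 / 2`, so their sum and difference stay in the
  -- unit ball, where the maximum `M` attained at `z` applies. Hence `M ≤ η + (M + M) / 4`.
  have hp : ‖(4 : ℝ) • (z - y)‖ ≤ 1 / 2 := by
    rw [norm_smul]; norm_num; linarith
  have hq : ‖(4 : ℝ)⁻¹ • (z + y)‖ ≤ 1 / 2 := by
    rw [norm_smul]; norm_num; linarith [norm_add_le z y, hA1 y hyA]
  have hpV : (4 : ℝ) • (z - y) ∈ V := V.smul_mem _ (V.sub_mem hzV hyV)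
  have hqV : (4 : ℝ)⁻¹ • (z + y) ∈ V := V.smul_mem _ (V.add_mem hzV hyV)
  have h1 := hle _ (V.add_mem hpV hqV) ((norm_add_le _ _).trans (by linarith))
  have h2 := hle _ (V.sub_mem hpV hqV) ((norm_sub_le _ _).trans (by linarith))
  have h3 := hη y hyA
  have e1 := norm_sq_sub_norm_sq_eq T z y
  have e2 := norm_sq_sub_norm_sq_eq D z y
  have h4 : |‖T z‖ ^ 2 - ‖D z‖ ^ 2| ≤ η + |‖T z‖ ^ 2 - ‖D z‖ ^ 2| / 2 := by
    rw [abs_le] at h1 h2 h3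
    refine abs_le.2 ⟨?_, ?_⟩ <;> linarith [h1.1, h1.2, h2.1, h2.2, h3.1, h3.2]
  linarith

end Net

/-! ### A grid on sparse vectors and its cardinality -/

section Grid

variable {L : ℕ}

/-- The vectors of `ℝ^L` supported on `T`. -/
def coordSubspace (T : Finset (Fin L)) : Submodule ℝ (EuclideanSpace ℝ (Fin L)) where
  carrier := {x | ∀ i ∉ T, x i = 0}
  add_mem' hx hy i hi := by simp [hx i hi, hy i hi]
  zero_mem' i _ := by simp
  smul_mem' c x hx i hi := by simp [hx i hi]

lemma mem_coordSubspace {T : Finset (Fin L)} {x : EuclideanSpace ℝ (Fin L)} :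
    x ∈ coordSubspace T ↔ ∀ i ∉ T, x i = 0 := Iff.rfl

open Classical in
/-- The points of the unit ball supported on `T` with coordinates in `(8L)⁻¹ ℤ`. -/
noncomputable def gridNet (T : Finset (Fin L)) : Finset (EuclideanSpace ℝ (Fin L)) :=
  ((Fintype.piFinset fun i => if i ∈ T then Finset.Icc (-(8 * L : ℤ)) (8 * L) else {0}).image
    fun z => WithLp.toLp 2 fun i => (z i : ℝ) / (8 * L)).filter fun y => ‖y‖ ≤ 1

lemma card_gridNet_le (T : Finset (Fin L)) : (gridNet T).card ≤ (16 * L + 1) ^ T.card := by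
  classical
  refine (Finset.card_filter_le _ _).trans (Finset.card_image_le.trans ?_)
  rw [Fintype.card_piFinset]
  have : ∀ i, (if i ∈ T then Finset.Icc (-(8 * L : ℤ)) (8 * L) else {0}).card =
      if i ∈ T then 16 * L + 1 else 1 := by
    intro i
    split_ifs
    · rw [Int.card_Icc]; omega
    · simp
  simp_rw [this]
  rw [Finset.prod_ite_mem, Finset.univ_inter, Finset.prod_const]

lemma norm_le_one_of_mem_gridNet {T : Finset (Fin L)} {y : EuclideanSpace ℝ (Fin L)}
    (hy : y ∈ gridNet T) : ‖y‖ ≤ 1 := (Finset.mem_filter.1 hy).2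

/-- Rounding towards zero keeps grid points in the unit ball and preserves zero coordinates. -/
lemma exists_int_abs_le_abs_sub_le_one (u : ℝ) : ∃ z : ℤ, |(z : ℝ)| ≤ |u| ∧ |u - z| ≤ 1 := by
  rcases le_total 0 u with h | h
  · refine ⟨⌊u⌋, ?_, ?_⟩
    · rw [abs_of_nonneg h, abs_of_nonneg (by exact_mod_cast Int.floor_nonneg.2 h)]
      exact Int.floor_le u
    · rw [abs_le]; constructor <;> linarith [Int.floor_le u, Int.lt_floor_add_one u]
  · refine ⟨⌈u⌉, ?_, ?_⟩
    · rw [abs_of_nonpos h, abs_of_nonpos (by exact_mod_cast Int.ceil_nonpos.2 h)]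
      linarith [Int.le_ceil u]
    · rw [abs_le]; constructor <;> linarith [Int.le_ceil u, Int.ceil_lt_add_one u]

lemma exists_mem_gridNet (hL : 0 < L) {T : Finset (Fin L)} {x : EuclideanSpace ℝ (Fin L)}
    (hxT : x ∈ coordSubspace T) (hx : ‖x‖ ≤ 1) :
    ∃ y ∈ gridNet T, y ∈ coordSubspace T ∧ ‖x - y‖ ≤ 1 / 8 := by
  classical
  have hL1 : (1 : ℝ) ≤ L := by exact_mod_cast hL
  have hm : (0 : ℝ) < 8 * L := by positivity
  choose z hz1 hz2 using fun i => exists_int_abs_le_abs_sub_le_one (8 * L * x i)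
  have hzT : ∀ i ∉ T, z i = 0 := by
    intro i hi
    have := hz1 i
    rw [mem_coordSubspace.1 hxT i hi, mul_zero, abs_zero] at this
    exact_mod_cast abs_nonpos_iff.1 this
  have hle : ∀ i, |(z i : ℝ) / (8 * L)| ≤ |x i| := by
    intro i
    rw [abs_div, abs_of_pos hm, div_le_iff₀ hm]
    calc _ ≤ _ := hz1 i
      _ = _ := by rw [abs_mul, abs_of_pos hm, mul_comm]
  have hxi : ∀ i, |x i| ≤ 1 := fun i => (PiLp.norm_apply_le x i).trans hx
  refine ⟨WithLp.toLp 2 fun i => (z i : ℝ) / (8 * L), ?_, ?_, ?_⟩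
  · refine Finset.mem_filter.2 ⟨Finset.mem_image_of_mem _ (Fintype.mem_piFinset.2 fun i => ?_), ?_⟩
    · split_ifs with hi
      · rw [Finset.mem_Icc, ← abs_le]
        have : |(z i : ℝ)| ≤ 8 * L := by
          have := (hle i).trans (hxi i)
          rwa [abs_div, abs_of_pos hm, div_le_one hm] at this
        exact_mod_cast this
      · simpa using hzT i hi
    · refine le_trans ?_ hx
      rw [EuclideanSpace.norm_eq, EuclideanSpace.norm_eq]
      refine Real.sqrt_le_sqrt (Finset.sum_le_sum fun i _ => ?_)
      have := hle i
      simp only [Real.norm_eq_abs]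
      gcongr
  · intro i hi
    simp [hzT i hi]
  -- Every coordinate error is at most `1 / (8 L)`, so the total squared error is at most `(1 / 8) ^
  -- 2 / L`.
  · rw [EuclideanSpace.norm_eq, Real.sqrt_le_left (by norm_num)]
    have : ∀ i, ‖(x - WithLp.toLp 2 fun i => (z i : ℝ) / (8 * L)) i‖ ^ 2 ≤
        (1 / (8 * L) : ℝ) ^ 2 := by
      intro i
      have e : (x - WithLp.toLp 2 fun i => (z i : ℝ) / (8 * L)) i =
          (8 * L * x i - z i) / (8 * L) := by
        simp only [PiLp.sub_apply]
        field_simp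
      rw [e, Real.norm_eq_abs, abs_div, abs_of_pos hm]
      gcongr
      exact hz2 i
    refine (Finset.sum_le_sum fun i _ => this i).trans ?_
    rw [Finset.sum_const, Finset.card_univ, Fintype.card_fin, nsmul_eq_mul]
    have e : (L : ℝ) * (1 / (8 * L)) ^ 2 = (1 / 8) ^ 2 / L := by field_simp
    rw [e]
    exact div_le_self (by positivity) hL1

lemma exists_support_subset {S : ℕ} {x : EuclideanSpace ℝ (Fin L)} (hx : IsSparse S x) :
    ∃ T ∈ Finset.powersetCard (min S L) Finset.univ, x ∈ coordSubspace T := by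
  classical
  have hc : (Finset.univ.filter fun i => x i ≠ 0).card ≤ min S L := by
    refine le_min ?_ ((Finset.card_le_univ _).trans (by simp))
    have := hx
    rwa [IsSparse, Set.ncard_eq_toFinset_card', Set.toFinset_ofPred] at this
  obtain ⟨T, hT, hcard⟩ := Finset.exists_superset_card_eq hc (by simp)
  refine ⟨T, Finset.mem_powersetCard.2 ⟨Finset.subset_univ _, hcard⟩, fun i hi => ?_⟩
  by_contra h
  exact hi (hT (by simpa using h))

/-- Per coordinate of the support, one factor `L` pays for choosing the support and `L ^ 6 ≥ 16 * L
+ 1` for the grid values; the latter needs `L ≥ 2`. -/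
lemma sum_card_gridNet_le (hL : 2 ≤ L) (S : ℕ) :
    ((∑ T ∈ Finset.powersetCard (min S L) (Finset.univ : Finset (Fin L)), (gridNet T).card : ℕ) : ℝ)
      ≤ Real.exp (7 * S * Real.log L) := by
  have h1 : ∑ T ∈ Finset.powersetCard (min S L) (Finset.univ : Finset (Fin L)), (gridNet T).card
      ≤ L ^ min S L * (16 * L + 1) ^ min S L := by
    calc _ ≤ ∑ T ∈ Finset.powersetCard (min S L) (Finset.univ : Finset (Fin L)),
          (16 * L + 1) ^ min S L := Finset.sum_le_sum fun T hT => by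
            rw [← (Finset.mem_powersetCard.1 hT).2]; exact card_gridNet_le T
      _ ≤ _ := by
        rw [Finset.sum_const, Finset.card_powersetCard, smul_eq_mul, Finset.card_univ,
          Fintype.card_fin]
        exact Nat.mul_le_mul_right _ (Nat.choose_le_pow _ _)
  have h2 : 16 * L + 1 ≤ L ^ 6 := by
    have : 2 ^ 5 ≤ L ^ 5 := Nat.pow_le_pow_left hL 5
    calc 16 * L + 1 ≤ 2 ^ 5 * L := by omega
      _ ≤ L ^ 5 * L := Nat.mul_le_mul_right _ this
      _ = L ^ 6 := by ring
  have h3 : L ^ min S L * (16 * L + 1) ^ min S L ≤ L ^ (7 * S) := by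
    calc _ ≤ L ^ min S L * (L ^ 6) ^ min S L := by gcongr
      _ = L ^ (7 * min S L) := by rw [← pow_mul, ← pow_add]; congr 1; ring
      _ ≤ _ := Nat.pow_le_pow_right (by omega) (by omega)
  have hL0 : (0 : ℝ) < L := by exact_mod_cast (by omega : 0 < L)
  calc _ ≤ ((L ^ (7 * S) : ℕ) : ℝ) := by exact_mod_cast h1.trans h3
    _ = _ := by
      rw [Nat.cast_pow, ← Real.exp_log (pow_pos hL0 _), Real.log_pow]
      push_cast; rfl

end Grid

/-! ### Column norms and the mean of the squared measurement norm -/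

section Columns

variable {N L K : ℕ} (G : Matrix (Fin N) (Fin L) ℝ)

lemma colNorm_sq (i : Fin L) : colNorm G i ^ 2 = ∑ n, G n i ^ 2 := by
  rw [colNorm, EuclideanSpace.norm_sq_eq]
  simp [Matrix.toLpLin_apply]

lemma colNorm_le_thetaMax (i : Fin L) : colNorm G i ≤ thetaMax G :=
  le_ciSup (Set.finite_range _).bddAbove i

lemma thetaMin_le_colNorm (i : Fin L) : thetaMin G ≤ colNorm G i :=
  ciInf_le (Set.finite_range _).bddBelow i

lemma norm_sq_measurementMatrix (φ : Fin K → Fin L → ℝ) (x : EuclideanSpace ℝ (Fin L)) :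
    ‖Matrix.toEuclideanLin (measurementMatrix G φ) x‖ ^ 2 =
      ∑ k, ∑ n, (∑ i, G n i * x i * φ k i) ^ 2 := by
  rw [EuclideanSpace.norm_sq_eq, Fintype.sum_prod_type]
  refine Finset.sum_congr rfl fun k _ => Finset.sum_congr rfl fun n _ => ?_
  rw [Real.norm_eq_abs, sq_abs]
  congr 1
  simp only [Matrix.toLpLin_apply, measurementMatrix, Matrix.mulVec, dotProduct,
    Matrix.of_apply, Matrix.mul_diagonal]
  exact Finset.sum_congr rfl fun i _ => by ring

/-- The diagonal map whose squared norm is the expectation of `‖H x‖ ^ 2`. -/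
noncomputable def meanMap (K : ℕ) : EuclideanSpace ℝ (Fin L) →ₗ[ℝ] EuclideanSpace ℝ (Fin L) :=
  Matrix.toEuclideanLin (Matrix.diagonal fun i => √(K : ℝ) * colNorm G i)

lemma norm_sq_meanMap (x : EuclideanSpace ℝ (Fin L)) :
    ‖meanMap G K x‖ ^ 2 = K * ∑ i, colNorm G i ^ 2 * x i ^ 2 := by
  rw [EuclideanSpace.norm_sq_eq, Finset.mul_sum]
  refine Finset.sum_congr rfl fun i _ => ?_
  rw [Real.norm_eq_abs, sq_abs]
  simp only [meanMap, Matrix.toLpLin_apply, Matrix.mulVec_diagonal]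
  rw [mul_pow, mul_pow, Real.sq_sqrt (Nat.cast_nonneg K), mul_assoc]

lemma sum_colNorm_sq_mul_sq (x : EuclideanSpace ℝ (Fin L)) :
    ∑ i, colNorm G i ^ 2 * x i ^ 2 = ∑ n, ∑ i, (G n i * x i) ^ 2 := by
  rw [Finset.sum_comm]
  refine Finset.sum_congr rfl fun i _ => ?_
  rw [colNorm_sq, Finset.sum_mul]
  exact Finset.sum_congr rfl fun n _ => by ring

variable {G}

lemma sum_colNorm_sq_mul_sq_le (x : EuclideanSpace ℝ (Fin L)) :
    ∑ i, colNorm G i ^ 2 * x i ^ 2 ≤ thetaMax G ^ 2 * ‖x‖ ^ 2 := by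
  rw [EuclideanSpace.norm_sq_eq, Finset.mul_sum]
  refine Finset.sum_le_sum fun i _ => ?_
  rw [Real.norm_eq_abs, sq_abs]
  have h0 : 0 ≤ colNorm G i := norm_nonneg _
  gcongr
  exact colNorm_le_thetaMax G i

lemma le_sum_colNorm_sq_mul_sq (hG : 0 < thetaMin G) (x : EuclideanSpace ℝ (Fin L)) :
    thetaMin G ^ 2 * ‖x‖ ^ 2 ≤ ∑ i, colNorm G i ^ 2 * x i ^ 2 := by
  rw [EuclideanSpace.norm_sq_eq, Finset.mul_sum]
  refine Finset.sum_le_sum fun i _ => ?_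
  rw [Real.norm_eq_abs, sq_abs]
  gcongr
  exact thetaMin_le_colNorm G i

lemma thetaMin_le_thetaMax (hL : 0 < L) : thetaMin G ≤ thetaMax G :=
  (thetaMin_le_colNorm G ⟨0, hL⟩).trans (colNorm_le_thetaMax G ⟨0, hL⟩)

lemma one_le_condRatio (hL : 0 < L) (hG : 0 < thetaMin G) : 1 ≤ condRatio G := by
  rw [condRatio, one_le_div (by positivity)]
  have := thetaMin_le_thetaMax (G := G) hL
  gcongr

end Columns

/-! ### From deviation bounds to restricted isometry -/

section Deterministic

lemma hasRIP_of_forall_sparseSphere {ι : Type*} [Fintype ι] {L S : ℕ}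
    {A : Matrix ι (Fin L) ℝ} {ε : ℝ} (h0 : 0 < ε) (h1 : ε < 1)
    (h : ∀ x ∈ sparseSphere S L, |‖Matrix.toEuclideanLin A x‖ ^ 2 - 1| ≤ ε) :
    HasRIP A S ε := by
  refine ⟨h0, h1, fun x hx => ?_⟩
  rcases eq_or_ne x 0 with rfl | hx0
  · simp
  have hn : 0 < ‖x‖ := norm_pos_iff.2 hx0
  have hmem : ‖x‖⁻¹ • x ∈ sparseSphere S L := by
    refine ⟨by rw [norm_smul, norm_inv, norm_norm, inv_mul_cancel₀ hn.ne'], ?_⟩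
    have e : {i : Fin L | (‖x‖⁻¹ • x) i ≠ 0} = {i | x i ≠ 0} := by
      ext i; simp [hx0]
    rw [IsSparse, e]; exact hx
  have h2 := abs_le.1 (h _ hmem)
  rw [map_smul, norm_smul, norm_inv, norm_norm, mul_pow, inv_pow] at h2
  have hn2 : 0 < ‖x‖ ^ 2 := by positivity
  set a := ‖Matrix.toEuclideanLin A x‖ ^ 2
  have e : a = ((‖x‖ ^ 2)⁻¹ * a) * ‖x‖ ^ 2 := by field_simp
  constructor
  · rw [e]; exact mul_le_mul_of_nonneg_right (by linarith) hn2.le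
  · rw [e]; exact mul_le_mul_of_nonneg_right (by linarith) hn2.le

variable {N L K S : ℕ} {G : Matrix (Fin N) (Fin L) ℝ}

/-- `F` is within `(θ_max² - θ_min²) / 2` of the midpoint `θ_avg²`; the deviation of `Z` from `K F`
adds the `2 δ` term. -/
lemma abs_div_thetaAvgSq_sub_one_le (hG : 0 < thetaMin G) (hK : 0 < K) {δ Z F : ℝ}
    (hF1 : thetaMin G ^ 2 ≤ F) (hF2 : F ≤ thetaMax G ^ 2)
    (hZ : |Z - K * F| ≤ K * δ * thetaMin G ^ 2) :
    |Z / (K * thetaAvgSq G) - 1| ≤ (condRatio G - 1 + 2 * δ) / (condRatio G + 1) := by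
  have hK' : (0 : ℝ) < K := by exact_mod_cast hK
  have hb : 0 < thetaMin G ^ 2 := by positivity
  have ha : 0 < thetaMax G ^ 2 := hb.trans_le (hF1.trans hF2)
  rw [thetaAvgSq, condRatio]
  set a := thetaMax G ^ 2
  set b := thetaMin G ^ 2
  have e1 : Z / (K * ((a + b) / 2)) - 1 = (2 * (Z - K * F) + K * (2 * F - (a + b))) /
      (K * (a + b)) := by field_simp; ring
  have e2 : (a / b - 1 + 2 * δ) / (a / b + 1) = (K * (a - b + 2 * δ * b)) / (K * (a + b)) := by
    field_simp
  rw [e1, e2, abs_div, abs_of_pos (by positivity : 0 < (K : ℝ) * (a + b))]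
  gcongr
  rw [abs_le] at hZ ⊢
  have h1 : (K : ℝ) * b ≤ K * F := by gcongr
  have h2 : (K : ℝ) * F ≤ K * a := by gcongr
  constructor <;> nlinarith [hZ.1, hZ.2]

lemma sparse_isometry_of_abs_sub_le (hL : 0 < L) (hG : 0 < thetaMin G) (hK : 0 < K) {δ : ℝ}
    (hδ0 : 0 < δ) (hδ1 : δ < 1) {φ : Fin K → Fin L → ℝ}
    (h : ∀ x ∈ sparseSphere S L,
      |‖Matrix.toEuclideanLin (measurementMatrix G φ) x‖ ^ 2 - ‖meanMap G K x‖ ^ 2| ≤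
        K * δ * thetaMin G ^ 2) :
    (∀ x ∈ sparseSphere S L,
      |‖Matrix.toEuclideanLin (measurementMatrix G φ) x‖ ^ 2 / ((K : ℝ) * thetaAvgSq G) - 1| ≤
        (condRatio G - 1 + 2 * δ) / (condRatio G + 1)) ∧
    HasRIP ((√((K : ℝ) * thetaAvgSq G))⁻¹ • measurementMatrix G φ) S
      ((condRatio G - 1 + 2 * δ) / (condRatio G + 1)) := by
  have h1 : ∀ x ∈ sparseSphere S L,
      |‖Matrix.toEuclideanLin (measurementMatrix G φ) x‖ ^ 2 / ((K : ℝ) * thetaAvgSq G) - 1| ≤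
        (condRatio G - 1 + 2 * δ) / (condRatio G + 1) := by
    intro x hx
    have hx1 : ‖x‖ = 1 := hx.1
    have hl := le_sum_colNorm_sq_mul_sq hG x
    have hu := sum_colNorm_sq_mul_sq_le (G := G) x
    rw [hx1, one_pow, mul_one] at hl hu
    refine abs_div_thetaAvgSq_sub_one_le hG hK hl hu ?_
    rw [← norm_sq_meanMap]
    exact h x hx
  have hμ := one_le_condRatio hL hG
  refine ⟨h1, hasRIP_of_forall_sparseSphere (div_pos (by linarith) (by linarith))
    ((div_lt_one (by linarith)).2 (by linarith)) fun x hx => ?_⟩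
  have hpos : 0 ≤ (K : ℝ) * thetaAvgSq G := by rw [thetaAvgSq]; positivity
  convert h1 x hx using 3
  rw [map_smul, LinearMap.smul_apply, norm_smul, norm_inv, Real.norm_of_nonneg (Real.sqrt_nonneg _),
    mul_pow, inv_pow, Real.sq_sqrt hpos, div_eq_inv_mul]

/-- A finite set of test vectors that controls differences of squared seminorms on the sparse
sphere. -/
lemma exists_finset_controlling_sparseSphere (hL : 0 < L) (S : ℕ) (F F' : Type*)
    [NormedAddCommGroup F] [InnerProductSpace ℝ F]
    [NormedAddCommGroup F'] [InnerProductSpace ℝ F'] :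
    ∃ A : Finset (EuclideanSpace ℝ (Fin L)), (∀ y ∈ A, ‖y‖ ≤ 1) ∧
      (A.card : ℝ) ≤ Real.exp (7 * S * Real.log L) ∧
      ∀ (T : EuclideanSpace ℝ (Fin L) →ₗ[ℝ] F) (D : EuclideanSpace ℝ (Fin L) →ₗ[ℝ] F') (η : ℝ),
        (∀ y ∈ A, |‖T y‖ ^ 2 - ‖D y‖ ^ 2| ≤ η) →
        ∀ x ∈ sparseSphere S L, |‖T x‖ ^ 2 - ‖D x‖ ^ 2| ≤ 2 * η := by
  classical
  rcases Nat.lt_or_ge L 2 with h | h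
  · obtain rfl : L = 1 := by omega
    -- For `L = 1` the logarithm vanishes and only one test vector is allowed; it suffices, as unit
    -- vectors are its multiples by `±1`.
    refine ⟨{EuclideanSpace.single 0 1}, by simp, by simp, fun T D η hη x hx => ?_⟩
    have h0 := hη _ (Finset.mem_singleton_self _)
    have e : x = x 0 • EuclideanSpace.single 0 (1 : ℝ) := by
      ext i
      rw [Subsingleton.elim i 0]
      simp
    have hx0 : ‖x 0‖ = 1 := by
      have h1 : ‖x‖ = 1 := hx.1
      rw [e, norm_smul] at h1
      simpa using h1
    rw [e, map_smul, map_smul, norm_smul, norm_smul, hx0, one_mul, one_mul]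
    linarith [abs_nonneg (‖T (EuclideanSpace.single 0 1)‖ ^ 2 -
      ‖D (EuclideanSpace.single 0 1)‖ ^ 2)]
  · refine ⟨(Finset.powersetCard (min S L) Finset.univ).biUnion gridNet, fun y hy => ?_, ?_,
      fun T D η hη x hx => ?_⟩
    · obtain ⟨T, _, hT⟩ := Finset.mem_biUnion.1 hy
      exact norm_le_one_of_mem_gridNet hT
    · exact le_trans (by exact_mod_cast Finset.card_biUnion_le) (sum_card_gridNet_le h S)
    · obtain ⟨U, hU, hxU⟩ := exists_support_subset hx.2
      exact abs_norm_sq_sub_norm_sq_le_of_net T D (coordSubspace U) (gridNet U)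
        (fun x hxU hx => exists_mem_gridNet hL hxU hx)
        (fun y hy => norm_le_one_of_mem_gridNet hy)
        (fun y hy => hη y (Finset.mem_biUnion.2 ⟨U, hU, hy⟩)) hxU (le_of_eq hx.1)

end Deterministic

/-! ### Tail bound for one vector and the final constants -/

lemma measure_measurementMatrix_deviation_le {Ω : Type*} [MeasurableSpace Ω] {P : Measure Ω}
    [IsProbabilityMeasure P] {N L K : ℕ} {G : Matrix (Fin N) (Fin L) ℝ}
    {φ : Fin K → Fin L → Ω → ℝ} (hφ : ∀ k i, HasLaw (φ k i) rademacher P)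
    (hind : iIndepFun (fun p : Fin K × Fin L => φ p.1 p.2) P) (hmax : 0 < thetaMax G)
    {y : EuclideanSpace ℝ (Fin L)} (hy : ‖y‖ ≤ 1) {t : ℝ} (ht0 : 0 ≤ t) (ht1 : t ≤ 1) :
    P.real {ω | K * t * thetaMax G ^ 2 ≤
        |‖Matrix.toEuclideanLin (measurementMatrix G fun k i => φ k i ω) y‖ ^ 2 -
          ‖meanMap G K y‖ ^ 2|} ≤
      2 * Real.exp (-(K * t ^ 2 / 2048)) := by
  simp_rw [norm_sq_measurementMatrix, norm_sq_meanMap, sum_colNorm_sq_mul_sq]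
  refine measure_rademacher_chaos_le (b := fun n i => G n i * y i) hφ hind (by positivity) ?_
    ht0 ht1
  rw [← sum_colNorm_sq_mul_sq]
  refine (sum_colNorm_sq_mul_sq_le y).trans (mul_le_of_le_one_right (by positivity) ?_)
  exact pow_le_one₀ (norm_nonneg _) hy

/-- The constant is `114688 = 7 * 4 * 4096`: the hypothesis gives `7 s ≤ K (δ / (2 μ))² / 4096`,
half of the available exponent. -/
lemma exponent_le {K s δ μ : ℝ} (hδ : 0 < δ) (hμ : 0 < μ) (hK : 0 ≤ K)
    (h : 114688 * ((δ ^ 2)⁻¹ * μ ^ 2 * s) ≤ K) :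
    7 * s - K * (δ / (2 * μ)) ^ 2 / 2048 ≤
      -(1 / 4096 * K * min (δ / (2 * μ)) (δ ^ 2 / (2 * μ) ^ 2)) := by
  have h1 : 1 / 4096 * K * min (δ / (2 * μ)) (δ ^ 2 / (2 * μ) ^ 2) ≤
      1 / 4096 * K * (δ ^ 2 / (2 * μ) ^ 2) := by
    gcongr; exact min_le_right _ _
  have h2 : 114688 * ((δ ^ 2)⁻¹ * μ ^ 2 * s) * (δ ^ 2 / (2 * μ) ^ 2) ≤
      K * (δ ^ 2 / (2 * μ) ^ 2) := by gcongr
  have e : 114688 * ((δ ^ 2)⁻¹ * μ ^ 2 * s) * (δ ^ 2 / (2 * μ) ^ 2) = 28672 * s := by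
    field_simp; ring
  rw [div_pow]
  linarith

end MaskImaging

open MaskImaging in
theorem theorem2 :
    ∃ c C : ℝ, 0 < c ∧ 0 < C ∧
      ∀ (N L K S : ℕ), 0 < L →
      ∀ (G : Matrix (Fin N) (Fin L) ℝ), 0 < thetaMin G →
      ∀ (δ : ℝ), 0 < δ → δ < 1 →
      ∀ {Ω : Type*} [MeasurableSpace Ω] (P : Measure Ω) [IsProbabilityMeasure P]
        (φ : Fin K → Fin L → Ω → ℝ),
        (∀ k i, HasLaw (φ k i) rademacher P) →
        iIndepFun (fun p : Fin K × Fin L => φ p.1 p.2) P →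
        c * ((δ ^ 2)⁻¹ * condRatio G ^ 2 * (S : ℝ) * Real.log (L : ℝ)) ≤ (K : ℝ) →
        1 - 2 * Real.exp (-(C * (K : ℝ) *
            min (δ / (2 * condRatio G)) (δ ^ 2 / (2 * condRatio G) ^ 2))) ≤
          P.real {ω |
            (∀ x ∈ sparseSphere S L,
              |‖Matrix.toEuclideanLin (measurementMatrix G fun k i => φ k i ω) x‖ ^ 2 /
                  ((K : ℝ) * thetaAvgSq G) - 1| ≤
                (condRatio G - 1 + 2 * δ) / (condRatio G + 1)) ∧
            HasRIP ((√((K : ℝ) * thetaAvgSq G))⁻¹ • measurementMatrix G fun k i => φ k i ω) S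
              ((condRatio G - 1 + 2 * δ) / (condRatio G + 1))} := by
  refine ⟨114688, 1 / 4096, by norm_num, by norm_num, ?_⟩
  intro N L K S hL G hG δ hδ0 hδ1 Ω _ P _ φ hφ hind hK
  -- For `K = 0` the claimed probability bound is `1 - 2 < 0`.
  rcases Nat.eq_zero_or_pos K with rfl | hK0
  · refine le_trans ?_ measureReal_nonneg
    norm_num
  set good := {ω | _}
  have hμ := one_le_condRatio hL hG
  have hmax : 0 < thetaMax G := hG.trans_le (thetaMin_le_thetaMax hL)
  set t := δ / (2 * condRatio G) with ht
  have ht0 : 0 ≤ t := by positivity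
  have ht1 : t ≤ 1 := by rw [ht, div_le_one (by positivity)]; linarith
  -- This fixes `t`: the `2` offsets the loss from the net, and `μ` converts `θ_max²` into `θ_min²`.
  have hτ : 2 * (K * t * thetaMax G ^ 2) = K * δ * thetaMin G ^ 2 := by
    rw [ht, condRatio]; field_simp
  obtain ⟨A, hA1, hAcard, hA⟩ := exists_finset_controlling_sparseSphere hL S
    (EuclideanSpace ℝ (Fin K × Fin N)) (EuclideanSpace ℝ (Fin L))
  set bad : EuclideanSpace ℝ (Fin L) → Set Ω := fun y => {ω | K * t * thetaMax G ^ 2 ≤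
        |‖Matrix.toEuclideanLin (measurementMatrix G fun k i => φ k i ω) y‖ ^ 2 -
          ‖meanMap G K y‖ ^ 2|} with hbad
  -- Covering the whole space and using subadditivity avoids any measurability of `good`.
  have hcover : (Set.univ : Set Ω) ⊆ good ∪ ⋃ y ∈ A, bad y := by
    intro ω _
    by_cases hω : ω ∈ ⋃ y ∈ A, bad y
    · exact Or.inr hω
    · left
      refine sparse_isometry_of_abs_sub_le hL hG hK0 hδ0 hδ1 ?_
      rw [← hτ]
      refine hA _ _ _ fun y hy => ?_
      by_contra hcon
      exact hω (Set.mem_biUnion hy (not_le.1 hcon).le)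
  have hbadP : P.real (⋃ y ∈ A, bad y) ≤ 2 * Real.exp (-(1 / 4096 * (K : ℝ) *
      min t (δ ^ 2 / (2 * condRatio G) ^ 2))) := by
    calc P.real (⋃ y ∈ A, bad y) ≤ ∑ y ∈ A, P.real (bad y) := measureReal_biUnion_finset_le _ _
      _ ≤ ∑ y ∈ A, 2 * Real.exp (-(K * t ^ 2 / 2048)) := Finset.sum_le_sum fun y hy =>
          measure_measurementMatrix_deviation_le hφ hind hmax (hA1 y hy) ht0 ht1
      _ = A.card * (2 * Real.exp (-(K * t ^ 2 / 2048))) := by rw [Finset.sum_const, nsmul_eq_mul]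
      _ ≤ Real.exp (7 * S * Real.log L) * (2 * Real.exp (-(K * t ^ 2 / 2048))) := by gcongr
      _ = 2 * Real.exp (7 * (S * Real.log L) - K * t ^ 2 / 2048) := by
          rw [mul_left_comm, ← Real.exp_add]; ring_nf
      _ ≤ _ := by
          gcongr
          exact exponent_le hδ0 (by linarith) (Nat.cast_nonneg K) (by rwa [← mul_assoc (_ * _)])
  have h1 : (1 : ℝ) ≤ P.real good + P.real (⋃ y ∈ A, bad y) := by
    rw [← probReal_univ (μ := P)]
    exact (measureReal_mono hcover).trans (measureReal_union_le _ _)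
  linarith
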